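/- Setting. Let $(\Omega,\mathscr F,(\mathscr F_t)_{t\ge0},\mathbb P)$ be a filtered probability space, let $S^0=(S^0_t)_{t\ge0}$ be a square-integrable right-continuous martingale on it, and put $\varphi(t)=\mathrm{Var}(S^0_t)$. Let $G:[0,\infty)\to[0,\infty)$, let $\mathbb T=\{t_0,\dots,t_N\}$ with $0\le t_0<t_1<\dots<t_N$, let $\theta,\gamma\ge0$, $n\ge1$, and $X_1,\dots,X_n\in\mathbb R$. If agents $i=1,\dots,n$ sell $\xi_{i,k}$ shares at time $t_k$, the asset price is $$S^{\Xi}_t=S^0_t-\sum_{t_k<t}G(t-t_k)\sum_{i=1}^n\xi_{i,k},$$ and the execution costs of agent $i$ are $$\mathscr C_{\mathbb T}(\boldsymbol\xi_i|\boldsymbol\xi_{-i})=\sum_{k=0}^N\Big[\tfrac{G(0)}2\xi_{i,k}^2-S^{\Xi}_{t_k}\xi_{i,k}+\tfrac{G(0)}2\sum_{j\ne i}\xi_{i,k}\xi_{j,k}+\theta\xi_{i,k}^2\Big].$$ Let $\mathscr X(X_i,\mathbb T)$ be the set of $\boldsymbol\xi=(\xi_0,\dots,\xi_N)$ such that each $\xi_k$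 is bounded and $\mathscr F_{t_k}$-measurable and $\sum_k\xi_k=X_i$, and let $\mathscr X_{\mathrm{det}}(X_i,\mathbb T)=\{\boldsymbol\xi\in\mathbb R^{N+1}:\sum_k\xi_k=X_i\}$ be its subset of deterministic strategies. A Nash equilibrium for mean-variance optimization is a family $(\boldsymbol\xi_1^*,\dots,\boldsymbol\xi_n^*)\in\prod_i\mathscr X_{\mathrm{det}}(X_i,\mathbb T)$ such that each $\boldsymbol\xi_i^*$ minimizes $\mathbb E[\mathscr C_{\mathbb T}(\boldsymbol\xi|\boldsymbol\xi_{-i}^*)]+\frac\gamma2\mathrm{Var}[\mathscr C_{\mathbb T}(\boldsymbol\xi|\boldsymbol\xi_{-i}^*)]$ over $\boldsymbol\xi\in\mathscr X_{\mathrm{det}}(X_i,\mathbb T)$. A Nash equilibrium for CARA utility maximization is a family $(\boldsymbol\xi_1^*,\dots,\boldsymbol\xi_n^*)\in\prod_i\mathscr X(X_i,\mathbb T)$ such that each $\boldsymbol\xi_i^*$ maximizes $\mathbb E[u_\gamma(-\mathscr C_{\mathbb T}(\boldsymbol\xi|\boldsymbol\xi_{-i}^*))]$ over $\boldsymbol\xi\in\mathscr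 X(X_i,\mathbb T)$, where $u_\gamma(x)=\frac1\gamma(1-e^{-\gamma x})$ for $\gamma>0$ and $u_0(x)=x$. For $i,j=0,\dots,N$ let $$\Gamma^{\gamma,\theta}_{ij}=G(|t_i-t_j|)+\gamma\varphi(t_i\wedge t_j)+2\theta\delta_{ij},\qquad \widetilde\Gamma_{ij}=\begin{cases}0&i<j,\\ \frac12\Gamma^{0,0}_{ii}&i=j,\\ \Gamma^{0,0}_{ij}&i>j.\end{cases}$$ Theorem. Assume that $\mathbb R\ni x\mapsto G(|x|)$ is strictly positive definite, that is, for all $m$ and all pairwise distinct $s_1,\dots,s_m\in\mathbb R$ the matrix $(G(|s_i-s_j|))_{i,j}$ is positive definite. Then, with $\boldsymbol 1=(1,\dots,1)^\top\in\mathbb R^{N+1}$, the vectors $$\boldsymbol v=\frac{[\Gamma^{\gamma,\theta}+(n-1)\widetilde\Gamma]^{-1}\boldsymbol 1}{\boldsymbol 1^\top[\Gamma^{\gamma,\theta}+(n-1)\widetilde\Gamma]^{-1}\boldsymbol 1},\qquad \boldsymbol w=\frac{[\Gamma^{\gamma,\theta}-\widetilde\Gamma]^{-1}\boldsymbol 1}{\boldsymbol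 1^\top[\Gamma^{\gamma,\theta}-\widetilde\Gamma]^{-1}\boldsymbol 1}$$ are well defined (both matrices are invertible and both denominators are nonzero), and with $\bar X=\frac1n\sum_{j=1}^nX_j$ the strategies $$\boldsymbol\xi_i^*=\bar X\boldsymbol v+(X_i-\bar X)\boldsymbol w,\qquad i=1,\dots,n,$$ form the unique Nash equilibrium for mean-variance optimization. If, moreover, $S^0$ is a Bachelier model, $S^0_t=S_0+\sigma B_t$ with constants $S_0,\sigma>0$ and a standard Brownian motion $B$ with respect to $(\mathscr F_t)_{t\ge0}$, then these strategies also form a Nash equilibrium for CARA utility maximization over the adapted strategies $\mathscr X(X_i,\mathbb T)$. -/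

import Mathlib

open MeasureTheory ProbabilityTheory
open scoped NNReal Matrix

namespace MarketImpact

noncomputable section

/-- A function `g : ℝ → ℝ` is strictly positive definite (in the sense of Bochner) if for all
pairwise distinct points `s₁, …, sₘ` the matrix `(g (sᵢ - sⱼ))` is positive definite. -/
def IsStrictlyPosDef (g : ℝ → ℝ) : Prop :=
  ∀ (m : ℕ) (s : Fin m → ℝ), Function.Injective s →
    (Matrix.of fun i j => g (s i - s j)).PosDef

/-- Standard one-dimensional Brownian motion on the filtered space `(Ω, ℱ, P)`: a Brownian motion
(with almost surely continuous paths, started at `0`) that is adapted to `ℱ` and whose increments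
after time `s` are independent of `ℱ s`. -/
structure IsFilteredBrownian {Ω : Type*} {mΩ : MeasurableSpace Ω}
    (B : ℝ≥0 → Ω → ℝ) (ℱ : Filtration ℝ≥0 mΩ) (P : Measure Ω) : Prop where
  isBrownian : IsBrownianReal B P
  adapted : StronglyAdapted ℱ B
  indep : ∀ s t : ℝ≥0, s ≤ t →
    Indep (MeasurableSpace.comap (fun ω => B t ω - B s ω) inferInstance) (ℱ s) P

/-- `S` is a Bachelier model `S_t = S₀ + σ B_t` with constants `S₀, σ > 0`. -/
def IsBachelier {Ω : Type*} {mΩ : MeasurableSpace Ω}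
    (S : ℝ≥0 → Ω → ℝ) (ℱ : Filtration ℝ≥0 mΩ) (P : Measure Ω) : Prop :=
  ∃ (S₀ σ : ℝ) (B : ℝ≥0 → Ω → ℝ), 0 < S₀ ∧ 0 < σ ∧ IsFilteredBrownian B ℱ P ∧
    ∀ t ω, S t ω = S₀ + σ * B t ω

/-- The standing assumption on the unaffected price process: it is a square-integrable,
right-continuous martingale. -/
structure IsUnaffectedPrice {Ω : Type*} {mΩ : MeasurableSpace Ω}
    (S : ℝ≥0 → Ω → ℝ) (ℱ : Filtration ℝ≥0 mΩ) (P : Measure Ω) : Prop where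
  martingale : Martingale S ℱ P
  sq_integrable : ∀ t, MemLp (S t) 2 P
  right_continuous : ∀ᵐ ω ∂P, ∀ t, ContinuousWithinAt (fun s => S s ω) (Set.Ici t) t

/-- The asset price at time `τ` when agent `i` sells `ξ i k` shares at time `t k`. -/
def price {Ω : Type*} {n N : ℕ} (G : ℝ≥0 → ℝ≥0) (S : ℝ≥0 → Ω → ℝ) (t : Fin (N + 1) → ℝ≥0)
    (ξ : Fin n → Fin (N + 1) → Ω → ℝ) (τ : ℝ≥0) (ω : Ω) : ℝ :=
  S τ ω - ∑ k with t k < τ, (G (τ - t k) : ℝ) * ∑ i, ξ i k ω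

/-- The execution costs of agent `i` when all agents use the strategies `ξ`. -/
def cost {Ω : Type*} {n N : ℕ} (G : ℝ≥0 → ℝ≥0) (S : ℝ≥0 → Ω → ℝ) (t : Fin (N + 1) → ℝ≥0)
    (θ : ℝ) (ξ : Fin n → Fin (N + 1) → Ω → ℝ) (i : Fin n) (ω : Ω) : ℝ :=
  ∑ k, ((G 0 : ℝ) / 2 * ξ i k ω ^ 2 - price G S t ξ (t k) ω * ξ i k ω
    + (G 0 : ℝ) / 2 * ∑ j with j ≠ i, ξ i k ω * ξ j k ω + θ * ξ i k ω ^ 2)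

/-- Adapted bounded strategies that liquidate the initial position `x`. -/
def adaptedStrategies {Ω : Type*} {mΩ : MeasurableSpace Ω} {N : ℕ} (ℱ : Filtration ℝ≥0 mΩ)
    (t : Fin (N + 1) → ℝ≥0) (x : ℝ) : Set (Fin (N + 1) → Ω → ℝ) :=
  {η | (∀ k, Measurable[ℱ (t k)] (η k)) ∧ (∀ k, ∃ c : ℝ, ∀ ω, |η k ω| ≤ c) ∧
    ∀ ω, ∑ k, η k ω = x}

/-- Deterministic strategies that liquidate the initial position `x`. -/
def detStrategies (N : ℕ) (x : ℝ) : Set (Fin (N + 1) → ℝ) :=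
  {η | ∑ k, η k = x}

/-- A profile of deterministic strategies, seen as a profile of constant random variables. -/
def constProfile (Ω : Type*) {n N : ℕ} (ξ : Fin n → Fin (N + 1) → ℝ) :
    Fin n → Fin (N + 1) → Ω → ℝ :=
  fun i k _ => ξ i k

/-- The mean-variance functional `E[C] + (γ / 2) Var[C]` of the costs `C` of agent `i` when the
agents use the deterministic strategies `ξ`. -/
def meanVariance {Ω : Type*} {mΩ : MeasurableSpace Ω} {n N : ℕ} (P : Measure Ω)
    (G : ℝ≥0 → ℝ≥0) (S : ℝ≥0 → Ω → ℝ) (t : Fin (N + 1) → ℝ≥0) (θ γ : ℝ)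
    (ξ : Fin n → Fin (N + 1) → ℝ) (i : Fin n) : ℝ :=
  (∫ ω, cost G S t θ (constProfile Ω ξ) i ω ∂P)
    + γ / 2 * variance (cost G S t θ (constProfile Ω ξ) i) P

/-- `ξ` is a Nash equilibrium for mean-variance optimization over deterministic strategies. -/
def IsMeanVarianceNash {Ω : Type*} {mΩ : MeasurableSpace Ω} {n N : ℕ} (P : Measure Ω)
    (G : ℝ≥0 → ℝ≥0) (S : ℝ≥0 → Ω → ℝ) (t : Fin (N + 1) → ℝ≥0) (θ γ : ℝ) (X : Fin n → ℝ)
    (ξ : Fin n → Fin (N + 1) → ℝ) : Prop :=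
  (∀ i, ξ i ∈ detStrategies N (X i)) ∧
    ∀ i, ∀ η ∈ detStrategies N (X i),
      meanVariance P G S t θ γ ξ i ≤ meanVariance P G S t θ γ (Function.update ξ i η) i

/-- The CARA utility function; the risk-neutral case `γ = 0` is the limit `x` as `γ → 0`. -/
def caraUtility (γ x : ℝ) : ℝ :=
  if γ = 0 then x else 1 / γ * (1 - Real.exp (-γ * x))

open Classical in
/-- Expected CARA utility of the revenues (negative costs) of agent `i`. For `γ > 0` the utility is
bounded above, so its expectation exists in `[-∞, 1 / γ]` and is `-∞` exactly when the utility is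
not integrable; for `γ = 0` the utility is integrable, since strategies are bounded and the
unaffected price is. -/
def expectedCARA {Ω : Type*} {mΩ : MeasurableSpace Ω} {n N : ℕ} (P : Measure Ω)
    (G : ℝ≥0 → ℝ≥0) (S : ℝ≥0 → Ω → ℝ) (t : Fin (N + 1) → ℝ≥0) (θ γ : ℝ)
    (ξ : Fin n → Fin (N + 1) → Ω → ℝ) (i : Fin n) : EReal :=
  if Integrable (fun ω => caraUtility γ (-cost G S t θ ξ i ω)) P then
    ((∫ ω, caraUtility γ (-cost G S t θ ξ i ω) ∂P : ℝ) : EReal)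
  else ⊥

/-- `ξ` is a Nash equilibrium for CARA utility maximization over adapted strategies. -/
def IsCARANash {Ω : Type*} {mΩ : MeasurableSpace Ω} {n N : ℕ} (P : Measure Ω)
    (ℱ : Filtration ℝ≥0 mΩ) (G : ℝ≥0 → ℝ≥0) (S : ℝ≥0 → Ω → ℝ) (t : Fin (N + 1) → ℝ≥0)
    (θ γ : ℝ) (X : Fin n → ℝ) (ξ : Fin n → Fin (N + 1) → Ω → ℝ) : Prop :=
  (∀ i, ξ i ∈ adaptedStrategies ℱ t (X i)) ∧
    ∀ i, ∀ η ∈ adaptedStrategies ℱ t (X i),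
      expectedCARA P G S t θ γ (Function.update ξ i η) i ≤ expectedCARA P G S t θ γ ξ i

/-- The matrix `Γ^{γ,θ}`, with `φ(t) = Var(S_t)`. -/
def Gam {Ω : Type*} {mΩ : MeasurableSpace Ω} {N : ℕ} (P : Measure Ω)
    (G : ℝ≥0 → ℝ≥0) (S : ℝ≥0 → Ω → ℝ) (t : Fin (N + 1) → ℝ≥0) (γ θ : ℝ) :
    Matrix (Fin (N + 1)) (Fin (N + 1)) ℝ :=
  Matrix.of fun i j => (G (Real.nnabs ((t i : ℝ) - t j)) : ℝ)
    + γ * variance (S (min (t i) (t j))) P + 2 * θ * (if i = j then 1 else 0)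

/-- The matrix `Γ̃`: the strictly lower triangular part of `Γ^{0,0}` plus half its diagonal. -/
def GamTilde {Ω : Type*} {mΩ : MeasurableSpace Ω} {N : ℕ} (P : Measure Ω)
    (G : ℝ≥0 → ℝ≥0) (S : ℝ≥0 → Ω → ℝ) (t : Fin (N + 1) → ℝ≥0) :
    Matrix (Fin (N + 1)) (Fin (N + 1)) ℝ :=
  Matrix.of fun i j =>
    if i < j then 0 else if i = j then 1 / 2 * Gam P G S t 0 0 i i else Gam P G S t 0 0 i j

/-- `(1ᵀ M⁻¹ 1)⁻¹ M⁻¹ 1`, the solution of `M x = 1` normalized to have coordinate sum one. -/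
def normalizedSol {N : ℕ} (M : Matrix (Fin (N + 1)) (Fin (N + 1)) ℝ) : Fin (N + 1) → ℝ :=
  (1 / (1 ⬝ᵥ (M⁻¹ *ᵥ 1))) • (M⁻¹ *ᵥ 1)

/-- The matrix `Γ^{γ,θ} + (n - 1) Γ̃`. -/
def matV {Ω : Type*} {mΩ : MeasurableSpace Ω} {N : ℕ} (P : Measure Ω) (n : ℕ)
    (G : ℝ≥0 → ℝ≥0) (S : ℝ≥0 → Ω → ℝ) (t : Fin (N + 1) → ℝ≥0) (γ θ : ℝ) :
    Matrix (Fin (N + 1)) (Fin (N + 1)) ℝ :=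
  Gam P G S t γ θ + ((n : ℝ) - 1) • GamTilde P G S t

/-- The matrix `Γ^{γ,θ} - Γ̃`. -/
def matW {Ω : Type*} {mΩ : MeasurableSpace Ω} {N : ℕ} (P : Measure Ω)
    (G : ℝ≥0 → ℝ≥0) (S : ℝ≥0 → Ω → ℝ) (t : Fin (N + 1) → ℝ≥0) (γ θ : ℝ) :
    Matrix (Fin (N + 1)) (Fin (N + 1)) ℝ :=
  Gam P G S t γ θ - GamTilde P G S t

/-- The strategies `ξᵢ* = X̄ v + (Xᵢ - X̄) w`, with `X̄` the average initial inventory. -/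
def optStrategy {Ω : Type*} {mΩ : MeasurableSpace Ω} {n N : ℕ} (P : Measure Ω)
    (G : ℝ≥0 → ℝ≥0) (S : ℝ≥0 → Ω → ℝ) (t : Fin (N + 1) → ℝ≥0) (θ γ : ℝ) (X : Fin n → ℝ) :
    Fin n → Fin (N + 1) → ℝ :=
  fun i => (1 / (n : ℝ) * ∑ j, X j) • normalizedSol (matV P n G S t γ θ)
    + (X i - 1 / (n : ℝ) * ∑ j, X j) • normalizedSol (matW P G S t γ θ)

end

end MarketImpact

/-! For deterministic strategies, agent `i` faces a convex quadratic functional of the own trades `ξ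
i`, with matrix `Γ^{γ,θ}` and linear part `Γ̃ ∑_{j≠i} ξ j`, up to a constant fixed by the total
position (`meanVariance_eq`). The own price impact `x ⬝ Γ̃ x` symmetrizes to half the decay form,
and the martingale property turns the variance into the form with entries `φ(t_i ∧ t_j)`.

An equilibrium is therefore a solution of the Lagrange conditions `Γ ξ_i + Γ̃ ∑_{j≠i} ξ_j = c_i 1`,
that is, `(Γ - Γ̃) ξ_i + Γ̃ ∑_j ξ_j = c_i 1`. Summing over the agents leaves `Γ + (n-1) Γ̃` acting
on the total; subtracting the average leaves `Γ - Γ̃` acting on the deviation of each agent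
(`firstOrder_iff`). Both matrices have positive definite symmetric part, so total and deviations are
determined by their coordinate sums.

In the Bachelier model with `γ > 0`, summation by parts writes the revenues from the price as a
stochastic sum of the remaining inventory against Brownian increments. Completing it to a stochastic
exponential factors `exp (γ C)` into a probability density and `exp` of the same quadratic
functional evaluated at the realized trades (`exists_density_exp_cost`). The second factor is
minimized for every `ω` by the deterministic optimum, so adaptedness brings no gain. For `γ = 0` the
martingale property alone gives this. -/

namespace MarketImpact

/-! ### Linear algebra of the first-order conditions. -/

section Quadratic

variable {N : ℕ}

/-- Positivity is phrased through the quadratic form and not as `PosDef`, because the matrices it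
serves need not be symmetric. -/
lemma isUnit_det_of_quadratic_pos {M : Matrix (Fin (N + 1)) (Fin (N + 1)) ℝ}
    (h : ∀ x, x ≠ 0 → 0 < x ⬝ᵥ (M *ᵥ x)) : IsUnit M.det := by
  rw [isUnit_iff_ne_zero]
  intro h0
  obtain ⟨v, hv, hv0⟩ := Matrix.exists_mulVec_eq_zero_iff.mpr h0
  have := h v hv
  simp [hv0] at this

lemma mulVec_inv_one {M : Matrix (Fin (N + 1)) (Fin (N + 1)) ℝ} (h : IsUnit M.det) :
    M *ᵥ (M⁻¹ *ᵥ 1) = 1 := by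
  rw [Matrix.mulVec_mulVec, Matrix.mul_nonsing_inv _ h, Matrix.one_mulVec]

lemma one_dotProduct_inv_ne_zero {M : Matrix (Fin (N + 1)) (Fin (N + 1)) ℝ}
    (h : ∀ x, x ≠ 0 → 0 < x ⬝ᵥ (M *ᵥ x)) : 1 ⬝ᵥ (M⁻¹ *ᵥ 1) ≠ 0 := by
  have hu := mulVec_inv_one (isUnit_det_of_quadratic_pos h)
  have hne : M⁻¹ *ᵥ 1 ≠ 0 := by
    intro h0
    rw [h0, Matrix.mulVec_zero] at hu
    exact zero_ne_one (congrFun hu 0)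
  have := h _ hne
  rw [hu, dotProduct_comm] at this
  exact this.ne'

lemma mulVec_normalizedSol {M : Matrix (Fin (N + 1)) (Fin (N + 1)) ℝ}
    (h : ∀ x, x ≠ 0 → 0 < x ⬝ᵥ (M *ᵥ x)) :
    M *ᵥ normalizedSol M = (1 / (1 ⬝ᵥ (M⁻¹ *ᵥ 1))) • (1 : Fin (N + 1) → ℝ) := by
  rw [normalizedSol, Matrix.mulVec_smul, mulVec_inv_one (isUnit_det_of_quadratic_pos h)]

lemma sum_normalizedSol {M : Matrix (Fin (N + 1)) (Fin (N + 1)) ℝ}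
    (h : ∀ x, x ≠ 0 → 0 < x ⬝ᵥ (M *ᵥ x)) : ∑ k, normalizedSol M k = 1 := by
  rw [← one_dotProduct, normalizedSol, dotProduct_smul, smul_eq_mul,
    one_div_mul_cancel (one_dotProduct_inv_ne_zero h)]

/-- A solution of `M x = c 1` is determined by its coordinate sum. -/
lemma eq_smul_normalizedSol {M : Matrix (Fin (N + 1)) (Fin (N + 1)) ℝ}
    (h : ∀ x, x ≠ 0 → 0 < x ⬝ᵥ (M *ᵥ x)) {x : Fin (N + 1) → ℝ} {c s : ℝ}
    (hx : M *ᵥ x = c • (1 : Fin (N + 1) → ℝ)) (hs : ∑ k, x k = s) :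
    x = s • normalizedSol M := by
  have hx' : x = c • (M⁻¹ *ᵥ 1) := by
    rw [← Matrix.mulVec_smul, ← hx, Matrix.mulVec_mulVec,
      Matrix.nonsing_inv_mul _ (isUnit_det_of_quadratic_pos h), Matrix.one_mulVec]
  have hc : s = c * (1 ⬝ᵥ (M⁻¹ *ᵥ 1)) := by
    rw [← hs, ← one_dotProduct, hx', dotProduct_smul, smul_eq_mul]
  have h0 := one_dotProduct_inv_ne_zero h
  rw [normalizedSol, smul_smul, hc, mul_assoc, mul_one_div_cancel h0, mul_one, ← hx']

/-- A linear-quadratic functional with matrix `A` and linear part `b`. -/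
noncomputable def linQuad (A : Matrix (Fin (N + 1)) (Fin (N + 1)) ℝ) (b x : Fin (N + 1) → ℝ) : ℝ :=
  1 / 2 * (x ⬝ᵥ (A *ᵥ x)) + x ⬝ᵥ b

/-- Exact second-order Taylor expansion; by symmetry the gradient at `x` is `A x + b`. -/
lemma linQuad_add {A : Matrix (Fin (N + 1)) (Fin (N + 1)) ℝ} (hA : A.IsSymm)
    (b x d : Fin (N + 1) → ℝ) :
    linQuad A b (x + d) = linQuad A b x + 1 / 2 * (d ⬝ᵥ (A *ᵥ d)) + d ⬝ᵥ (A *ᵥ x + b) := by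
  have hs : x ⬝ᵥ (A *ᵥ d) = d ⬝ᵥ (A *ᵥ x) := by
    rw [Matrix.dotProduct_mulVec, ← Matrix.mulVec_transpose, hA.eq, dotProduct_comm]
  simp only [linQuad, Matrix.mulVec_add, dotProduct_add, add_dotProduct, hs]
  ring

lemma eq_zero_of_forall_sq_mul_add_nonneg {a b : ℝ} (h : ∀ s : ℝ, 0 ≤ s ^ 2 * a + s * b) :
    b = 0 := by
  have := discrim_le_zero (a := a) (b := b) (c := 0) fun s => by nlinarith [h s]
  rw [discrim] at this
  nlinarith [sq_nonneg b]

/-- First-order condition for minimizing a convex linear-quadratic functional over the vectors with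
given coordinate sum. -/
lemma linQuad_minimal_iff {A : Matrix (Fin (N + 1)) (Fin (N + 1)) ℝ} (hA : A.IsSymm)
    (hp : ∀ x, 0 ≤ x ⬝ᵥ (A *ᵥ x)) (b x : Fin (N + 1) → ℝ) :
    (∀ η : Fin (N + 1) → ℝ, ∑ k, η k = ∑ k, x k → linQuad A b x ≤ linQuad A b η) ↔
      ∃ c : ℝ, A *ᵥ x + b = c • (1 : Fin (N + 1) → ℝ) := by
  constructor
  · intro h
    refine ⟨(A *ᵥ x + b) 0, funext fun k => ?_⟩
    set g := A *ᵥ x + b with hg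
    -- The directions `e_k - e_0` preserve the coordinate sum, so stationarity along them makes
    -- every coordinate of the gradient equal to the zeroth, which is the multiplier.
    have key := eq_zero_of_forall_sq_mul_add_nonneg
      (a := 1 / 2 * ((Pi.single k 1 - Pi.single 0 1 : Fin (N + 1) → ℝ) ⬝ᵥ
        (A *ᵥ (Pi.single k 1 - Pi.single 0 1))))
      (b := (Pi.single k 1 - Pi.single 0 1 : Fin (N + 1) → ℝ) ⬝ᵥ g) (fun s => by
        have := h (x + s • (Pi.single k 1 - Pi.single 0 1)) (by
          simp [Finset.sum_add_distrib, ← Finset.mul_sum])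
        rw [linQuad_add hA, ← hg, Matrix.mulVec_smul] at this
        simp only [smul_dotProduct, dotProduct_smul, smul_eq_mul] at this
        linarith)
    rw [sub_dotProduct, single_one_dotProduct, single_one_dotProduct] at key
    simp only [Pi.smul_apply, Pi.one_apply, smul_eq_mul, mul_one]
    linarith
  · rintro ⟨c, hc⟩ η hη
    have h1 := linQuad_add hA b x (η - x)
    rw [add_sub_cancel, hc, dotProduct_smul, dotProduct_one] at h1
    simp only [Pi.sub_apply, Finset.sum_sub_distrib, hη, sub_self, smul_zero, add_zero] at h1
    linarith [hp (η - x)]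

/-- The first-order conditions of all agents determine their strategies. -/
lemma firstOrder_iff {n : ℕ} (hn : 1 ≤ n) {A T V W : Matrix (Fin (N + 1)) (Fin (N + 1)) ℝ}
    (hVdef : V = A + ((n : ℝ) - 1) • T) (hWdef : W = A - T)
    (hV : ∀ x, x ≠ 0 → 0 < x ⬝ᵥ (V *ᵥ x)) (hW : ∀ x, x ≠ 0 → 0 < x ⬝ᵥ (W *ᵥ x))
    (X : Fin n → ℝ) (ξ : Fin n → Fin (N + 1) → ℝ) :
    ((∀ i, ∑ k, ξ i k = X i) ∧
      ∀ i, ∃ c : ℝ, A *ᵥ ξ i + T *ᵥ (∑ j with j ≠ i, ξ j) = c • (1 : Fin (N + 1) → ℝ)) ↔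
    ξ = fun i => (1 / (n : ℝ) * ∑ j, X j) • normalizedSol V
      + (X i - 1 / (n : ℝ) * ∑ j, X j) • normalizedSol W := by
  have hn0 : (n : ℝ) ≠ 0 := by positivity
  -- Moving `T ξ_i` into the sum makes the coupling term the same for all agents.
  have hsum : ∀ (ξ : Fin n → Fin (N + 1) → ℝ) i,
      A *ᵥ ξ i + T *ᵥ (∑ j with j ≠ i, ξ j) = W *ᵥ ξ i + T *ᵥ (∑ j, ξ j) := by
    intro ξ i
    have : ∑ j, ξ j = ξ i + ∑ j with j ≠ i, ξ j := by
      rw [Finset.filter_ne', Finset.add_sum_erase _ _ (Finset.mem_univ i)]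
    rw [this, hWdef, Matrix.mulVec_add, Matrix.sub_mulVec]
    abel
  have hVW : V = W + (n : ℝ) • T := by
    rw [hVdef, hWdef, sub_smul, one_smul]; abel
  constructor
  · rintro ⟨hX, hc⟩
    choose c hc using hc
    have hc' : ∀ i, W *ᵥ ξ i = c i • 1 - T *ᵥ (∑ j, ξ j) := fun i => by
      rw [← hc i, hsum ξ i, add_sub_cancel_right]
    have hXs : ∑ k, (∑ j, ξ j) k = ∑ j, X j := by
      simp only [Finset.sum_apply]
      rw [Finset.sum_comm]
      exact Finset.sum_congr rfl fun j _ => hX j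
    have hVs : V *ᵥ (∑ j, ξ j) = (∑ j, c j) • (1 : Fin (N + 1) → ℝ) := by
      rw [hVW, Matrix.add_mulVec, Matrix.mulVec_sum]
      simp only [hc', Finset.sum_sub_distrib, Finset.sum_const, Finset.card_univ, Fintype.card_fin,
        ← Finset.sum_smul, Matrix.smul_mulVec]
      rw [← Nat.cast_smul_eq_nsmul ℝ n, sub_add_cancel]
    have htot := eq_smul_normalizedSol hV hVs hXs
    funext i
    -- The common coupling term cancels against its average, so the deviations decouple.
    have hd : W *ᵥ (ξ i - (1 / (n : ℝ)) • ∑ j, ξ j) =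
        (c i - 1 / n * ∑ j, c j) • (1 : Fin (N + 1) → ℝ) := by
      have h1 : W *ᵥ (∑ j, ξ j) = (∑ j, c j) • 1 - (n : ℝ) • (T *ᵥ (∑ j, ξ j)) := by
        rw [← hVs, hVW, Matrix.add_mulVec, Matrix.smul_mulVec, add_sub_cancel_right]
      rw [Matrix.mulVec_sub, Matrix.mulVec_smul, h1, hc' i, smul_sub, smul_smul, smul_smul,
        one_div_mul_cancel hn0, one_smul, sub_smul]
      abel
    have hd' := eq_smul_normalizedSol hW hd (s := X i - 1 / n * ∑ j, X j) (by
      simp only [Pi.sub_apply, Pi.smul_apply, smul_eq_mul, Finset.sum_sub_distrib, hX i,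
        ← Finset.mul_sum, hXs])
    rw [← hd', htot, smul_smul]
    abel
  · intro hξ
    have hXi : ∀ i, ∑ k, ξ i k = X i := fun i => by
      rw [hξ]
      simp only [Pi.add_apply, Pi.smul_apply, smul_eq_mul, Finset.sum_add_distrib,
        ← Finset.mul_sum, sum_normalizedSol hV, sum_normalizedSol hW]
      ring
    refine ⟨hXi, fun i => ?_⟩
    rw [hsum, hξ]
    set m := 1 / (n : ℝ) * ∑ j, X j with hm
    have htot : ∑ j, (m • normalizedSol V + (X j - m) • normalizedSol W)
        = (n * m) • normalizedSol V := by
      rw [Finset.sum_add_distrib, ← Finset.sum_smul, ← Finset.sum_smul, Finset.sum_sub_distrib]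
      simp only [Finset.sum_const, Finset.card_univ, Fintype.card_fin, nsmul_eq_mul]
      have : ∑ j, X j - n * m = 0 := by rw [hm]; field_simp; ring
      rw [this, zero_smul, add_zero]
    rw [htot]
    refine ⟨m * (1 / (1 ⬝ᵥ (V⁻¹ *ᵥ 1))) + (X i - m) * (1 / (1 ⬝ᵥ (W⁻¹ *ᵥ 1))), ?_⟩
    have h1 : W *ᵥ normalizedSol V + (n : ℝ) • (T *ᵥ normalizedSol V) = V *ᵥ normalizedSol V := by
      rw [hVW, Matrix.add_mulVec, Matrix.smul_mulVec]
    have h2 : W *ᵥ (m • normalizedSol V + (X i - m) • normalizedSol W)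
        + T *ᵥ ((n * m) • normalizedSol V) =
        m • (W *ᵥ normalizedSol V + (n : ℝ) • (T *ᵥ normalizedSol V))
          + (X i - m) • (W *ᵥ normalizedSol W) := by
      rw [Matrix.mulVec_add, Matrix.mulVec_smul, Matrix.mulVec_smul, Matrix.mulVec_smul, smul_add,
        smul_smul, mul_comm m]
      abel
    rw [h2, h1, mulVec_normalizedSol hV, mulVec_normalizedSol hW, smul_smul, smul_smul, add_smul]

end Quadratic

end MarketImpact

namespace MarketImpact

/-! ### Costs as quadratic forms, and the mean-variance equilibrium. -/

section Costs

variable {Ω : Type*} {mΩ : MeasurableSpace Ω} {n N : ℕ} {P : Measure Ω}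
  {G : ℝ≥0 → ℝ≥0} {S : ℝ≥0 → Ω → ℝ} {t : Fin (N + 1) → ℝ≥0} {θ γ : ℝ}

/-- The matrix `G(|t_i - t_j|)`. -/
noncomputable def decayMatrix (G : ℝ≥0 → ℝ≥0) (t : Fin (N + 1) → ℝ≥0) :
    Matrix (Fin (N + 1)) (Fin (N + 1)) ℝ :=
  Matrix.of fun i j => (G (Real.nnabs ((t i : ℝ) - t j)) : ℝ)

/-- The matrix `Var(S_{t_i ∧ t_j})`. -/
noncomputable def varMatrix (P : Measure Ω) (S : ℝ≥0 → Ω → ℝ) (t : Fin (N + 1) → ℝ≥0) :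
    Matrix (Fin (N + 1)) (Fin (N + 1)) ℝ :=
  Matrix.of fun i j => variance (S (min (t i) (t j))) P

lemma Gam_eq : Gam P G S t γ θ =
    decayMatrix G t + γ • varMatrix P S t + (2 * θ) • (1 : Matrix (Fin (N + 1)) _ ℝ) := by
  ext i j
  simp [Gam, decayMatrix, varMatrix, Matrix.one_apply]

lemma decayMatrix_isSymm : (decayMatrix G t).IsSymm := by
  ext i j
  simp only [decayMatrix, Matrix.transpose_apply, Matrix.of_apply]
  rw [show (t j : ℝ) - t i = -((t i : ℝ) - t j) by ring]
  congr 2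
  ext
  simp only [Real.coe_nnabs, abs_neg]

lemma Gam_isSymm : (Gam P G S t γ θ).IsSymm := by
  rw [Gam_eq]
  refine (decayMatrix_isSymm.add (Matrix.IsSymm.smul ?_ γ)).add (Matrix.isSymm_one.smul _)
  ext i j
  simp [varMatrix, min_comm]

lemma dotProduct_Gam_mulVec (x : Fin (N + 1) → ℝ) :
    x ⬝ᵥ (Gam P G S t γ θ *ᵥ x) = x ⬝ᵥ (decayMatrix G t *ᵥ x)
      + γ * (x ⬝ᵥ (varMatrix P S t *ᵥ x)) + 2 * θ * (x ⬝ᵥ x) := by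
  rw [Gam_eq]
  simp [Matrix.add_mulVec, Matrix.smul_mulVec, dotProduct_add]

lemma decayMatrix_pos (hG : IsStrictlyPosDef fun x : ℝ => (G (Real.nnabs x) : ℝ))
    (ht : StrictMono t) {x : Fin (N + 1) → ℝ} (hx : x ≠ 0) :
    0 < x ⬝ᵥ (decayMatrix G t *ᵥ x) := by
  have := (hG (N + 1) (fun i => (t i : ℝ))
    (NNReal.coe_injective.comp ht.injective)).dotProduct_mulVec_pos hx
  simpa [decayMatrix] using this

/-- The halved diagonal is what makes the symmetric part of `Γ̃` exactly half the decay matrix; the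
positivity of both equilibrium matrices rests on this. -/
lemma GamTilde_add_transpose :
    GamTilde P G S t + (GamTilde P G S t)ᵀ = decayMatrix G t := by
  have h : Gam P G S t 0 0 = decayMatrix G t := by simp [Gam_eq]
  have hs := fun i j => congrFun (congrFun (decayMatrix_isSymm (G := G) (t := t)) i) j
  ext i j
  simp only [GamTilde, h, Matrix.add_apply, Matrix.transpose_apply, Matrix.of_apply]
  rcases lt_trichotomy i j with hij | rfl | hij
  · simpa [hij, hij.not_gt, hij.ne'] using hs i j
  · simp only [lt_irrefl, if_false, if_true]; ring
  · simp [hij, hij.not_gt, hij.ne']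

lemma dotProduct_GamTilde_mulVec (x : Fin (N + 1) → ℝ) :
    x ⬝ᵥ (GamTilde P G S t *ᵥ x) = 1 / 2 * (x ⬝ᵥ (decayMatrix G t *ᵥ x)) := by
  have : x ⬝ᵥ ((GamTilde P G S t)ᵀ *ᵥ x) = x ⬝ᵥ (GamTilde P G S t *ᵥ x) := by
    rw [Matrix.mulVec_transpose, dotProduct_comm, ← Matrix.dotProduct_mulVec]
  rw [← GamTilde_add_transpose (P := P) (S := S), Matrix.add_mulVec, dotProduct_add, this]
  ring

/-- This is the price impact felt at `t k`: earlier trades act with full decayed weight,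
simultaneous ones with weight `G 0 / 2`. -/
lemma GamTilde_mulVec_apply (ht : StrictMono t) (y : Fin (N + 1) → ℝ) (k : Fin (N + 1)) :
    (GamTilde P G S t *ᵥ y) k =
      ∑ m with t m < t k, (G (t k - t m) : ℝ) * y m + (G 0 : ℝ) / 2 * y k := by
  have h : Gam P G S t 0 0 = decayMatrix G t := by simp [Gam_eq]
  have hk : (G 0 : ℝ) / 2 * y k = ∑ m, if m = k then (G 0 : ℝ) / 2 * y m else 0 := by simp
  rw [hk, Finset.sum_filter, ← Finset.sum_add_distrib, Matrix.mulVec, dotProduct]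
  refine Finset.sum_congr rfl fun m _ => ?_
  simp only [GamTilde, h, Matrix.of_apply, ht.lt_iff_lt]
  rcases lt_trichotomy m k with hm | rfl | hm
  · have : Real.nnabs ((t k : ℝ) - t m) = t k - t m := by
      rw [← NNReal.coe_sub (ht hm).le, Real.nnabs_coe]
    simp [hm, hm.not_gt, hm.ne, hm.ne', decayMatrix, this]
  · simp only [lt_irrefl, if_false, if_true, decayMatrix, Matrix.of_apply, sub_self, map_zero]
    ring
  · simp [hm, hm.not_gt, hm.ne']

/-- Decomposition of the costs into impact costs, transaction costs and the revenues that are due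
to the unaffected price. -/
lemma cost_eq (P : Measure Ω) (ht : StrictMono t) (ξ : Fin n → Fin (N + 1) → Ω → ℝ) (i : Fin n)
    (ω : Ω) :
    cost G S t θ ξ i ω = linQuad (Gam P G S t 0 θ)
      (GamTilde P G S t *ᵥ ∑ j with j ≠ i, fun k => ξ j k ω) (fun k => ξ i k ω)
      - ∑ k, ξ i k ω * S (t k) ω := by
  set x : Fin (N + 1) → ℝ := fun k => ξ i k ω with hx
  set y : Fin (N + 1) → ℝ := ∑ j with j ≠ i, fun k => ξ j k ω with hy
  have hsum : ∀ k, ∑ j, ξ j k ω = x k + y k := fun k => by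
    rw [hx, hy, Finset.sum_apply, Finset.filter_ne',
      Finset.add_sum_erase _ (fun j => ξ j k ω) (Finset.mem_univ i)]
  -- Own and foreign trades enter the costs through the same `Γ̃`; only the own part is quadratic in
  -- `x` and may be symmetrized.
  have h1 : linQuad (Gam P G S t 0 θ) (GamTilde P G S t *ᵥ y) x =
      x ⬝ᵥ (GamTilde P G S t *ᵥ (x + y)) + θ * (x ⬝ᵥ x) := by
    rw [linQuad, dotProduct_Gam_mulVec, Matrix.mulVec_add, dotProduct_add,
      dotProduct_GamTilde_mulVec x]
    ring
  rw [h1]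
  simp only [dotProduct, GamTilde_mulVec_apply ht, Finset.mul_sum _ _ θ, ← Finset.sum_add_distrib,
    ← Finset.sum_sub_distrib, cost, price, hsum, Pi.add_apply]
  refine Finset.sum_congr rfl fun k _ => ?_
  have hyk : ∑ j with j ≠ i, ξ i k ω * ξ j k ω = x k * y k := by
    rw [← Finset.mul_sum, hy, Finset.sum_apply]
  rw [hyk]
  change (G 0 : ℝ) / 2 * x k ^ 2 - (_ - _) * x k + (G 0 : ℝ) / 2 * (x k * y k) + θ * x k ^ 2
    = _ + θ * (x k * x k) - x k * _
  ring

lemma martingale_integral_mul {ℱ : Filtration ℝ≥0 mΩ} [IsProbabilityMeasure P]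
    (hS : Martingale S ℱ P) {s u : ℝ≥0} (hsu : s ≤ u) {f : Ω → ℝ}
    (hf : Measurable[ℱ s] f) (hi : Integrable (f * S u) P) :
    ∫ ω, f ω * S s ω ∂P = ∫ ω, f ω * S u ω ∂P := by
  have h1 := condExp_mul_of_stronglyMeasurable_left (μ := P) hf.stronglyMeasurable hi
    (hS.integrable u)
  have h2 := integral_condExp (ℱ.le s) (μ := P) (f := f * S u)
  change _ = ∫ ω, (f * S u) ω ∂P
  rw [← h2]
  refine integral_congr_ae ?_
  filter_upwards [h1, hS.condExp_ae_eq hsu] with ω h1 h2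
  rw [h1, Pi.mul_apply, h2]

lemma martingale_integral_eq {ℱ : Filtration ℝ≥0 mΩ} (hS : Martingale S ℱ P)
    [IsProbabilityMeasure P] (s u : ℝ≥0) : ∫ ω, S s ω ∂P = ∫ ω, S u ω ∂P := by
  wlog h : s ≤ u generalizing s u
  · exact (this u s (le_of_not_ge h)).symm
  simpa using hS.setIntegral_eq h MeasurableSet.univ

/-- Conditioning on the earlier time gives `E[S_s S_u] = E[S_s²]` for `s ≤ u`, and the means agree.
-/
lemma covariance_of_martingale {ℱ : Filtration ℝ≥0 mΩ} [IsProbabilityMeasure P]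
    (hS : Martingale S ℱ P) (h2 : ∀ s, MemLp (S s) 2 P) (s u : ℝ≥0) :
    covariance (S s) (S u) P = variance (S (min s u)) P := by
  wlog h : s ≤ u generalizing s u
  · rw [covariance_comm, min_comm, this u s (le_of_not_ge h)]
  have h3 := martingale_integral_mul hS h (hS.stronglyAdapted s).measurable
    ((h2 s).integrable_mul (h2 u))
  rw [min_eq_left h, ← covariance_self (h2 s).aestronglyMeasurable.aemeasurable,
    covariance_eq_sub (h2 s) (h2 u),
    covariance_eq_sub (h2 s) (h2 s), martingale_integral_eq hS u s]
  simp only [Pi.mul_apply]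
  rw [h3]

lemma variance_sum_mul {ℱ : Filtration ℝ≥0 mΩ} [IsProbabilityMeasure P]
    (hS : Martingale S ℱ P) (h2 : ∀ s, MemLp (S s) 2 P) (t : Fin (N + 1) → ℝ≥0)
    (x : Fin (N + 1) → ℝ) :
    variance (fun ω => ∑ k, x k * S (t k) ω) P = x ⬝ᵥ (varMatrix P S t *ᵥ x) := by
  have hm : ∀ k, MemLp (fun ω => x k * S (t k) ω) 2 P := fun k => (h2 (t k)).const_mul (x k)
  rw [← covariance_self (memLp_finsetSum _ fun k _ => hm k).aestronglyMeasurable.aemeasurable,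
    covariance_fun_sum_fun_sum hm hm]
  simp only [dotProduct, Matrix.mulVec, varMatrix, Matrix.of_apply, Finset.mul_sum]
  refine Finset.sum_congr rfl fun k _ => Finset.sum_congr rfl fun l _ => ?_
  rw [covariance_const_mul_left, covariance_const_mul_right, covariance_of_martingale hS h2]
  ring

lemma varMatrix_nonneg {ℱ : Filtration ℝ≥0 mΩ} [IsProbabilityMeasure P]
    (hS : IsUnaffectedPrice S ℱ P) (x : Fin (N + 1) → ℝ) :
    0 ≤ x ⬝ᵥ (varMatrix P S t *ᵥ x) := by
  rw [← variance_sum_mul hS.martingale hS.sq_integrable]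
  exact variance_nonneg _ _

lemma dotProduct_self_nonneg_real (x : Fin (N + 1) → ℝ) : 0 ≤ x ⬝ᵥ x :=
  Finset.sum_nonneg fun _ _ => mul_self_nonneg _

lemma Gam_nonneg {ℱ : Filtration ℝ≥0 mΩ} [IsProbabilityMeasure P]
    (hS : IsUnaffectedPrice S ℱ P)
    (hG : IsStrictlyPosDef fun x : ℝ => (G (Real.nnabs x) : ℝ)) (ht : StrictMono t)
    (hθ : 0 ≤ θ) (hγ : 0 ≤ γ) (x : Fin (N + 1) → ℝ) :
    0 ≤ x ⬝ᵥ (Gam P G S t γ θ *ᵥ x) := by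
  have h1 : 0 ≤ x ⬝ᵥ (decayMatrix G t *ᵥ x) := by
    rcases eq_or_ne x 0 with rfl | hx
    · simp
    · exact (decayMatrix_pos hG ht hx).le
  rw [dotProduct_Gam_mulVec]
  have := mul_nonneg hγ (varMatrix_nonneg (t := t) hS x)
  have := mul_nonneg (mul_nonneg zero_le_two hθ) (dotProduct_self_nonneg_real x)
  positivity

lemma matV_pos {ℱ : Filtration ℝ≥0 mΩ} [IsProbabilityMeasure P]
    (hS : IsUnaffectedPrice S ℱ P)
    (hG : IsStrictlyPosDef fun x : ℝ => (G (Real.nnabs x) : ℝ)) (ht : StrictMono t)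
    (hθ : 0 ≤ θ) (hγ : 0 ≤ γ) (hn : 1 ≤ n) (x : Fin (N + 1) → ℝ) (hx : x ≠ 0) :
    0 < x ⬝ᵥ (matV P n G S t γ θ *ᵥ x) := by
  have h1 := decayMatrix_pos hG ht hx
  have h2 := mul_nonneg hγ (varMatrix_nonneg (t := t) hS x)
  have h3 := mul_nonneg (mul_nonneg zero_le_two hθ) (dotProduct_self_nonneg_real x)
  have h4 : (0 : ℝ) ≤ n - 1 := by
    rw [sub_nonneg]; exact_mod_cast hn
  rw [matV, Matrix.add_mulVec, Matrix.smul_mulVec, dotProduct_add, dotProduct_smul, smul_eq_mul,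
    dotProduct_GamTilde_mulVec, dotProduct_Gam_mulVec]
  have := mul_nonneg h4 (mul_nonneg (by norm_num : (0 : ℝ) ≤ 1 / 2) h1.le)
  linarith

/-- Subtracting `Γ̃` costs only half of the decay form, so a positive half remains. -/
lemma matW_pos {ℱ : Filtration ℝ≥0 mΩ} [IsProbabilityMeasure P]
    (hS : IsUnaffectedPrice S ℱ P)
    (hG : IsStrictlyPosDef fun x : ℝ => (G (Real.nnabs x) : ℝ)) (ht : StrictMono t)
    (hθ : 0 ≤ θ) (hγ : 0 ≤ γ) (x : Fin (N + 1) → ℝ) (hx : x ≠ 0) :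
    0 < x ⬝ᵥ (matW P G S t γ θ *ᵥ x) := by
  have h1 := decayMatrix_pos hG ht hx
  have h2 := mul_nonneg hγ (varMatrix_nonneg (t := t) hS x)
  have h3 := mul_nonneg (mul_nonneg zero_le_two hθ) (dotProduct_self_nonneg_real x)
  rw [matW, Matrix.sub_mulVec, dotProduct_sub, dotProduct_GamTilde_mulVec, dotProduct_Gam_mulVec]
  linarith

lemma linQuad_Gam (b x : Fin (N + 1) → ℝ) :
    linQuad (Gam P G S t γ θ) b x =
      linQuad (Gam P G S t 0 θ) b x + γ / 2 * (x ⬝ᵥ (varMatrix P S t *ᵥ x)) := by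
  rw [linQuad, linQuad, dotProduct_Gam_mulVec, dotProduct_Gam_mulVec]
  ring

/-- The martingale has constant mean, so the expected revenue from the unaffected price depends only
on the total sold and drops out of the optimization. -/
lemma meanVariance_eq {ℱ : Filtration ℝ≥0 mΩ} [IsProbabilityMeasure P]
    (hS : IsUnaffectedPrice S ℱ P) (ht : StrictMono t) (ξ : Fin n → Fin (N + 1) → ℝ) (i : Fin n) :
    meanVariance P G S t θ γ ξ i = linQuad (Gam P G S t γ θ)
      (GamTilde P G S t *ᵥ ∑ j with j ≠ i, ξ j) (ξ i) - (∑ k, ξ i k) * ∫ ω, S 0 ω ∂P := by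
  have hc : cost G S t θ (constProfile Ω ξ) i = fun ω => linQuad (Gam P G S t 0 θ)
      (GamTilde P G S t *ᵥ ∑ j with j ≠ i, ξ j) (ξ i) - ∑ k, ξ i k * S (t k) ω :=
    funext fun ω => cost_eq P ht _ i ω
  have hm : ∀ k, MemLp (fun ω => ξ i k * S (t k) ω) 2 P :=
    fun k => (hS.sq_integrable (t k)).const_mul (ξ i k)
  have hi : ∀ k, Integrable (fun ω => ξ i k * S (t k) ω) P :=
    fun k => (hS.martingale.integrable (t k)).const_mul (ξ i k)
  have hmean : ∀ k, ∫ ω, S (t k) ω ∂P = ∫ ω, S 0 ω ∂P :=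
    fun k => martingale_integral_eq hS.martingale _ _
  rw [meanVariance, hc, integral_sub (integrable_const _) (integrable_finsetSum _ fun k _ => hi k),
    integral_finsetSum _ fun k _ => hi k,
    variance_const_sub (memLp_finsetSum _ fun k _ => hm k).aestronglyMeasurable,
    variance_sum_mul hS.martingale hS.sq_integrable, linQuad_Gam (γ := γ)]
  simp only [integral_const_mul, hmean, ← Finset.sum_mul, integral_const, probReal_univ, one_smul]
  ring

lemma sum_update_ne {M : Type*} [AddCommMonoid M] (ξ : Fin n → M) (i : Fin n) (η : M) :
    ∑ j with j ≠ i, Function.update ξ i η j = ∑ j with j ≠ i, ξ j :=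
  Finset.sum_congr rfl fun _ hj => Function.update_of_ne (Finset.mem_filter.mp hj).2 _ _

lemma isMeanVarianceNash_iff_linQuad {ℱ : Filtration ℝ≥0 mΩ} [IsProbabilityMeasure P]
    (hS : IsUnaffectedPrice S ℱ P) (ht : StrictMono t) (X : Fin n → ℝ)
    (ξ : Fin n → Fin (N + 1) → ℝ) :
    IsMeanVarianceNash P G S t θ γ X ξ ↔ (∀ i, ∑ k, ξ i k = X i) ∧
      ∀ i, ∀ η : Fin (N + 1) → ℝ, ∑ k, η k = ∑ k, ξ i k →
        linQuad (Gam P G S t γ θ) (GamTilde P G S t *ᵥ ∑ j with j ≠ i, ξ j) (ξ i) ≤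
          linQuad (Gam P G S t γ θ) (GamTilde P G S t *ᵥ ∑ j with j ≠ i, ξ j) η := by
  refine and_congr_right fun hX => forall_congr' fun i => forall_congr' fun η => ?_
  have hXi : ∑ k, ξ i k = X i := hX i
  rw [detStrategies, Set.mem_ofPred_eq, hXi]
  refine imp_congr_right fun hη => ?_
  rw [meanVariance_eq hS ht, meanVariance_eq hS ht, sum_update_ne, Function.update_self, hη, hXi,
    sub_le_sub_iff_right]

lemma isMeanVarianceNash_iff {ℱ : Filtration ℝ≥0 mΩ} [IsProbabilityMeasure P]
    (hS : IsUnaffectedPrice S ℱ P)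
    (hG : IsStrictlyPosDef fun x : ℝ => (G (Real.nnabs x) : ℝ)) (ht : StrictMono t)
    (hθ : 0 ≤ θ) (hγ : 0 ≤ γ) (hn : 1 ≤ n) (X : Fin n → ℝ) (ξ : Fin n → Fin (N + 1) → ℝ) :
    IsMeanVarianceNash P G S t θ γ X ξ ↔ ξ = optStrategy P G S t θ γ X := by
  rw [isMeanVarianceNash_iff_linQuad hS ht]
  simp_rw [linQuad_minimal_iff Gam_isSymm (Gam_nonneg hS hG ht hθ hγ)]
  exact firstOrder_iff hn rfl rfl (matV_pos hS hG ht hθ hγ hn) (matW_pos hS hG ht hθ hγ) X ξ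

end Costs

end MarketImpact

namespace MarketImpact

/-! ### Stochastic exponentials of discretely rebalanced Brownian positions. -/

section ExponentialMartingale

open scoped ENNReal

variable {Ω : Type*} {mΩ : MeasurableSpace Ω} {P : Measure Ω}

/-- With `∫⁻`, the later products of exponentials can be evaluated before anything is known about
their integrability. -/
lemma lintegral_exp_gaussianReal (v : ℝ≥0) (r : ℝ) :
    ∫⁻ y, ENNReal.ofReal (Real.exp (r * y - r ^ 2 * v / 2)) ∂gaussianReal 0 v = 1 := by
  have h1 : ∀ y, Real.exp (r * y - r ^ 2 * v / 2) =
      Real.exp (-(r ^ 2 * v / 2)) * Real.exp (r * y) := fun y => by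
    rw [← Real.exp_add]; congr 1; ring
  have h2 : ∫ y, Real.exp (r * y) ∂gaussianReal 0 v = Real.exp (r ^ 2 * v / 2) := by
    have := congrFun (mgf_id_gaussianReal (μ := 0) (v := v)) r
    rw [mgf] at this
    simp only [id] at this
    rw [this]; congr 1; ring
  simp_rw [h1]
  rw [← ofReal_integral_eq_lintegral_ofReal ((integrable_exp_mul_gaussianReal r).const_mul _)
    (Filter.Eventually.of_forall fun y => by positivity), integral_const_mul, h2, ← Real.exp_add]
  simp

/-- The exponential of a centred Gaussian variable with a scale that is independent of it. -/
lemma lintegral_mul_exp_of_indep {Ω : Type*} {m mΩ : MeasurableSpace Ω} {P : Measure Ω}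
    [IsProbabilityMeasure P] (hm : m ≤ mΩ)
    {Z : Ω → ℝ≥0∞} {R D : Ω → ℝ} {v : ℝ≥0} (hZ : Measurable[m] Z) (hR : Measurable[m] R)
    (hD : Measurable D) (hlaw : P.map D = gaussianReal 0 v)
    (hind : Indep (MeasurableSpace.comap D inferInstance) m P) :
    ∫⁻ ω, Z ω * ENNReal.ofReal (Real.exp (R ω * D ω - R ω ^ 2 * v / 2)) ∂P = ∫⁻ ω, Z ω ∂P := by
  have hZR : Measurable[m] fun ω => (Z ω, R ω) := hZ.prodMk hR
  have hif : IndepFun (fun ω => (Z ω, R ω)) D P := by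
    rw [IndepFun_iff_Indep]
    exact (indep_of_indep_of_le_right hind hZR.comap_le).symm
  have hmap := hif.map_prod_eq_prod_map_map (hZR.mono hm le_rfl).aemeasurable hD.aemeasurable
  have hF : Measurable fun p : (ℝ≥0∞ × ℝ) × ℝ =>
      p.1.1 * ENNReal.ofReal (Real.exp (p.1.2 * p.2 - p.1.2 ^ 2 * v / 2)) := by fun_prop
  have h1 := lintegral_map (μ := P) hF ((hZR.mono hm le_rfl).prodMk hD)
  -- Independence gives a product law, so Tonelli integrates `D` out with `Z` and `R` frozen.
  rw [hmap, hlaw, lintegral_prod _ hF.aemeasurable,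
    lintegral_map hF.lintegral_prod_right' (hZR.mono hm le_rfl)] at h1
  rw [← h1]
  refine lintegral_congr fun ω => ?_
  rw [lintegral_const_mul _ (by fun_prop), lintegral_exp_gaussianReal, mul_one]

lemma IsFilteredBrownian.map_sub {B : ℝ≥0 → Ω → ℝ} {ℱ : Filtration ℝ≥0 mΩ}
    (hB : IsFilteredBrownian B ℱ P) {s u : ℝ≥0} (h : s ≤ u) :
    P.map (fun ω => B u ω - B s ω) = gaussianReal 0 (u - s) := by
  have := (hB.isBrownian.toIsPreBrownianReal.hasLaw_sub u s).map_eq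
  have hd : nndist (u : ℝ) (s : ℝ) = u - s := by
    ext
    rw [coe_nndist, Real.dist_eq, NNReal.coe_sub h, abs_of_nonneg (sub_nonneg.mpr (NNReal.coe_le_coe.mpr h))]
  rwa [show (u.1 : ℝ) = (u : ℝ) from rfl, show (s.1 : ℝ) = (s : ℝ) from rfl, hd] at this

/-- Discrete stochastic exponentials of Brownian motion have expectation one. -/
lemma lintegral_exp_stochastic_sum [IsProbabilityMeasure P] {B : ℝ≥0 → Ω → ℝ}
    {ℱ : Filtration ℝ≥0 mΩ} (hB : IsFilteredBrownian B ℱ P) {s : ℕ → ℝ≥0} (hs : Monotone s)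
    {R : ℕ → Ω → ℝ} (hR : ∀ k, Measurable[ℱ (s k)] (R k)) (m : ℕ) :
    ∫⁻ ω, ENNReal.ofReal (Real.exp (∑ k ∈ Finset.range m, (R k ω * (B (s (k + 1)) ω - B (s k) ω)
      - R k ω ^ 2 * ((s (k + 1) : ℝ) - s k) / 2))) ∂P = 1 := by
  have hBm : ∀ k j, k ≤ j → Measurable[ℱ (s j)] (B (s k)) := fun k j h =>
    (hB.adapted (s k)).measurable.mono (ℱ.mono (hs h)) le_rfl
  induction m with
  | zero => simp
  | succ m ih =>
    -- The first `m` factors are known at time `s m`, and the increment after it is independent of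
    -- them, so the last factor integrates to one.
    refine Eq.trans ?_ ((lintegral_mul_exp_of_indep (ℱ.le (s m)) ?_ (hR m)
      (D := fun ω => B (s (m + 1)) ω - B (s m) ω) ?_
      (hB.map_sub (hs m.le_succ)) (hB.indep _ _ (hs m.le_succ))).trans ih)
    · refine lintegral_congr fun ω => ?_
      rw [Finset.sum_range_succ, Real.exp_add, ENNReal.ofReal_mul (Real.exp_pos _).le,
        NNReal.coe_sub (hs m.le_succ)]
    · refine (Real.measurable_exp.comp (Finset.measurable_sum _ fun k hk => ?_)).ennreal_ofReal
      have hk' : k < m := Finset.mem_range.mp hk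
      have hRk : Measurable[ℱ (s m)] (R k) := (hR k).mono (ℱ.mono (hs hk'.le)) le_rfl
      exact (hRk.mul ((hBm (k + 1) m hk').sub (hBm k m hk'.le))).sub
        (((hRk.pow_const 2).mul_const _).div_const _)
    · exact ((hBm (m + 1) (m + 1) le_rfl).mono (ℱ.le _) le_rfl).sub
        ((hBm m m le_rfl).mono (ℱ.le _) le_rfl)

lemma sum_range_if_le_sub (b : ℕ → ℝ) {m l : ℕ} (hl : l < m) :
    ∑ k ∈ Finset.range m, (if k ≤ l then b (k + 1) - b k else 0) = b (l + 1) - b 0 := by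
  rw [← Finset.sum_filter, ← Finset.sum_range_sub b (l + 1)]
  congr 1
  ext k
  simp only [Finset.mem_filter, Finset.mem_range]
  omega

/-- Summation by parts for the remaining inventory. -/
lemma sum_tail_mul {N : ℕ} (x : Fin (N + 1) → ℝ) (b : ℕ → ℝ) :
    ∑ k ∈ Finset.range (N + 1), (∑ l : Fin (N + 1), if k ≤ l then x l else 0) * (b (k + 1) - b k)
      = ∑ l : Fin (N + 1), x l * (b (l + 1) - b 0) := by
  simp_rw [Finset.sum_mul]
  rw [Finset.sum_comm]
  refine Finset.sum_congr rfl fun l _ => ?_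
  rw [← sum_range_if_le_sub b l.isLt, Finset.mul_sum]
  exact Finset.sum_congr rfl fun k _ => by split_ifs <;> simp

/-- The quadratic-variation counterpart of `sum_tail_mul`: a pair `(l, j)` contributes for `k ≤ min
l j`, where the increments telescope. -/
lemma sum_tail_sq_mul {N : ℕ} (x : Fin (N + 1) → ℝ) (b : ℕ → ℝ) :
    ∑ k ∈ Finset.range (N + 1),
      (∑ l : Fin (N + 1), if k ≤ l then x l else 0) ^ 2 * (b (k + 1) - b k)
      = ∑ l : Fin (N + 1), x l * ∑ j : Fin (N + 1), (b (min l j + 1) - b 0) * x j := by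
  simp_rw [sq, Finset.sum_mul_sum, Finset.mul_sum, Finset.sum_mul]
  rw [Finset.sum_comm]
  refine Finset.sum_congr rfl fun l _ => ?_
  rw [Finset.sum_comm]
  refine Finset.sum_congr rfl fun j _ => ?_
  rw [← sum_range_if_le_sub b (min l j).isLt, Finset.sum_mul, Finset.mul_sum]
  refine Finset.sum_congr rfl fun k _ => ?_
  by_cases h1 : k ≤ (l : ℕ) <;> by_cases h2 : k ≤ (j : ℕ) <;> simp [h1, h2]; ring

/-- Adapted strategies that liquidate a constant position turn a Brownian motion into an
exponential variable with expectation one. -/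
lemma lintegral_exp_strategy [IsProbabilityMeasure P] {B : ℝ≥0 → Ω → ℝ}
    {ℱ : Filtration ℝ≥0 mΩ} (hB : IsFilteredBrownian B ℱ P) {N : ℕ} {t : Fin (N + 1) → ℝ≥0}
    (ht : Monotone t) {x : ℝ} {η : Fin (N + 1) → Ω → ℝ} (hη : ∀ k, Measurable[ℱ (t k)] (η k))
    (hsum : ∀ ω, ∑ k, η k ω = x) :
    ∫⁻ ω, ENNReal.ofReal (Real.exp (∑ k, η k ω * B (t k) ω
      - 1 / 2 * ∑ k, η k ω * ∑ l, ((min (t k) (t l) : ℝ≥0) : ℝ) * η l ω)) ∂P = 1 := by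
  -- The grid `s` is `0, t_0, …, t_N`, then constant. The shift by one puts time `0` in front, so
  -- that the increments sum up to `B` itself.
  let c : ℕ → Fin (N + 1) := fun k => ⟨min k N, by omega⟩
  have hc : ∀ l : Fin (N + 1), c l = l := fun l => Fin.ext (min_eq_left (Nat.lt_succ_iff.mp l.isLt))
  obtain ⟨s, hs0, hs1⟩ : ∃ s : ℕ → ℝ≥0, s 0 = 0 ∧ ∀ k, s (k + 1) = t (c k) :=
    ⟨fun k => Nat.casesOn k 0 fun k => t (c k), rfl, fun _ => rfl⟩
  have hs : Monotone s := by
    refine monotone_nat_of_le_succ fun k => ?_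
    cases k with
    | zero => exact hs0 ▸ zero_le
    | succ k =>
      rw [hs1, hs1]
      exact ht (Fin.mk_le_mk.mpr (min_le_min_right _ k.le_succ))
  -- Inventory held over `[s k, s (k + 1)]`. As a sum of future trades it looks anticipating; since
  -- the total is the constant `x`, it equals `x` minus the trades already made and is measurable at
  -- time `s k`.
  let R : ℕ → Ω → ℝ := fun k ω => ∑ l : Fin (N + 1), if k ≤ l then η l ω else 0
  have hR' : ∀ k, R k = fun ω => x - ∑ l : Fin (N + 1), if k ≤ l then 0 else η l ω := fun k => by
    funext ω
    rw [← hsum ω, ← Finset.sum_sub_distrib]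
    exact Finset.sum_congr rfl fun l _ => by split_ifs <;> simp
  have hR : ∀ k, Measurable[ℱ (s k)] (R k) := fun k => by
    rw [hR']
    refine measurable_const.sub (Finset.measurable_sum _ fun l _ => ?_)
    split_ifs with h
    · exact measurable_const
    · refine (hη l).mono (ℱ.mono ?_) le_rfl
      calc t l = s (l + 1) := by rw [hs1, hc]
        _ ≤ s k := hs (show (l : ℕ) + 1 ≤ k by omega)
  rw [← lintegral_exp_stochastic_sum hB hs hR (N + 1)]
  refine lintegral_congr_ae ?_
  filter_upwards [hB.isBrownian.toIsPreBrownianReal.eval_zero_ae_eq_zero] with ω h0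
  have h1 := sum_tail_mul (fun l => η l ω) fun k => B (s k) ω
  have h2 := sum_tail_sq_mul (fun l => η l ω) fun k => ((s k : ℝ≥0) : ℝ)
  have hmin : ∀ l j : Fin (N + 1), t (min l j) = min (t l) (t j) := fun l j =>
    ht.map_min
  simp only [hs1, hs0, hc, h0, sub_zero, NNReal.coe_zero, hmin] at h1 h2
  rw [Finset.sum_sub_distrib, ← Finset.sum_div, ← h1, ← h2]
  congr 2
  simp only [hs1]
  ring

end ExponentialMartingale

end MarketImpact

namespace MarketImpact

/-! ### Optimality among adapted strategies. -/

section CARA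

variable {Ω : Type*} {mΩ : MeasurableSpace Ω} {n N : ℕ} {P : Measure Ω}
  {G : ℝ≥0 → ℝ≥0} {S : ℝ≥0 → Ω → ℝ} {t : Fin (N + 1) → ℝ≥0} {θ γ : ℝ} {ℱ : Filtration ℝ≥0 mΩ}

lemma cost_update_constProfile (P : Measure Ω) (ht : StrictMono t) (ξ : Fin n → Fin (N + 1) → ℝ)
    (i : Fin n) (η : Fin (N + 1) → Ω → ℝ) (ω : Ω) :
    cost G S t θ (Function.update (constProfile Ω ξ) i η) i ω = linQuad (Gam P G S t 0 θ)
      (GamTilde P G S t *ᵥ ∑ j with j ≠ i, ξ j) (fun k => η k ω)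
      - ∑ k, η k ω * S (t k) ω := by
  have h : ∑ j with j ≠ i, (fun k => Function.update (constProfile Ω ξ) i η j k ω) =
      ∑ j with j ≠ i, ξ j := Finset.sum_congr rfl fun j hj => by
    rw [Function.update_of_ne (Finset.mem_filter.mp hj).2]
    rfl
  rw [cost_eq P ht, h, Function.update_self]

lemma constProfile_mem_adaptedStrategies {ξ : Fin n → Fin (N + 1) → ℝ} {i : Fin n} {x : ℝ}
    (h : ∑ k, ξ i k = x) : constProfile Ω ξ i ∈ adaptedStrategies ℱ t x :=
  ⟨fun _ => measurable_const, fun k => ⟨|ξ i k|, fun _ => le_rfl⟩, fun _ => h⟩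

lemma integrable_strategy_mul [IsProbabilityMeasure P] (hS : Martingale S ℱ P) {x : ℝ}
    {η : Fin (N + 1) → Ω → ℝ} (hη : η ∈ adaptedStrategies ℱ t x) (k : Fin (N + 1)) (s : ℝ≥0) :
    Integrable (fun ω => η k ω * S s ω) P := by
  obtain ⟨c, hc⟩ := hη.2.1 k
  exact (hS.integrable s).bdd_mul ((hη.1 k).mono (ℱ.le _) le_rfl).aestronglyMeasurable
    (Filter.Eventually.of_forall hc)

/-- The expected revenues from the unaffected price do not depend on the strategy. -/
lemma integral_sum_strategy_mul [IsProbabilityMeasure P] (hS : Martingale S ℱ P)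
    (ht : StrictMono t) {x : ℝ} {η : Fin (N + 1) → Ω → ℝ} (hη : η ∈ adaptedStrategies ℱ t x) :
    ∫ ω, ∑ k, η k ω * S (t k) ω ∂P = x * ∫ ω, S 0 ω ∂P := by
  have hi := integrable_strategy_mul hS hη
  rw [integral_finsetSum _ fun k _ => hi k _]
  -- Moving every trade to the last date lets the trades add up to the constant `x`.
  have h : ∀ k, ∫ ω, η k ω * S (t k) ω ∂P = ∫ ω, η k ω * S (t (Fin.last N)) ω ∂P := fun k =>
    martingale_integral_mul hS (ht.monotone (Fin.le_last k)) (hη.1 k) (hi k _)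
  simp_rw [h]
  rw [← integral_finsetSum _ fun k _ => hi k _, martingale_integral_eq hS 0 (t (Fin.last N)),
    ← integral_const_mul]
  exact integral_congr_ae (Filter.Eventually.of_forall fun ω => by
    simp only [← Finset.sum_mul, hη.2.2 ω])

lemma expectedCARA_of_integrable {ξ : Fin n → Fin (N + 1) → Ω → ℝ} {i : Fin n}
    (h : Integrable (fun ω => caraUtility γ (-cost G S t θ ξ i ω)) P) :
    expectedCARA P G S t θ γ ξ i = ((∫ ω, caraUtility γ (-cost G S t θ ξ i ω) ∂P : ℝ) : EReal) :=
  if_pos h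

/-- A non-integrable utility has value `⊥`, so integrability of a competitor's utility may be
assumed. -/
lemma expectedCARA_le {ξ : Fin n → Fin (N + 1) → Ω → ℝ} {i : Fin n} {u : ℝ}
    (h : Integrable (fun ω => caraUtility γ (-cost G S t θ ξ i ω)) P →
      ∫ ω, caraUtility γ (-cost G S t θ ξ i ω) ∂P ≤ u) :
    expectedCARA P G S t θ γ ξ i ≤ u := by
  rw [expectedCARA]
  split_ifs with hi
  · exact_mod_cast h hi
  · exact bot_le

/-- Optimality among adapted strategies in the risk-neutral case. -/
lemma expectedCARA_zero_le [IsProbabilityMeasure P] (hS : Martingale S ℱ P)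
    (ht : StrictMono t) {ξ : Fin n → Fin (N + 1) → ℝ} {i : Fin n} {x : ℝ} (hξ : ∑ k, ξ i k = x)
    (hmin : ∀ y : Fin (N + 1) → ℝ, ∑ k, y k = x →
      linQuad (Gam P G S t 0 θ) (GamTilde P G S t *ᵥ ∑ j with j ≠ i, ξ j) (ξ i) ≤
        linQuad (Gam P G S t 0 θ) (GamTilde P G S t *ᵥ ∑ j with j ≠ i, ξ j) y)
    {η : Fin (N + 1) → Ω → ℝ} (hη : η ∈ adaptedStrategies ℱ t x) :
    expectedCARA P G S t θ 0 (Function.update (constProfile Ω ξ) i η) i ≤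
      expectedCARA P G S t θ 0 (constProfile Ω ξ) i := by
  set b := GamTilde P G S t *ᵥ ∑ j with j ≠ i, ξ j with hb
  have hu : ∀ ζ : Fin (N + 1) → Ω → ℝ, ∀ ω,
      caraUtility 0 (-cost G S t θ (Function.update (constProfile Ω ξ) i ζ) i ω) =
        ∑ k, ζ k ω * S (t k) ω - linQuad (Gam P G S t 0 θ) b (fun k => ζ k ω) := fun ζ ω => by
    rw [caraUtility, if_pos rfl, cost_update_constProfile P ht, neg_sub]
  have hi : ∀ {ζ : Fin (N + 1) → Ω → ℝ}, ζ ∈ adaptedStrategies ℱ t x →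
      Integrable (fun ω => ∑ k, ζ k ω * S (t k) ω) P := fun hζ =>
    integrable_finsetSum _ fun k _ => integrable_strategy_mul hS hζ k _
  have hmem := constProfile_mem_adaptedStrategies (Ω := Ω) (ℱ := ℱ) (t := t) hξ
  have hrhs : expectedCARA P G S t θ 0 (constProfile Ω ξ) i =
      ((x * ∫ ω, S 0 ω ∂P - linQuad (Gam P G S t 0 θ) b (ξ i) : ℝ) : EReal) := by
    have hfun : ∀ ω, caraUtility 0 (-cost G S t θ (constProfile Ω ξ) i ω) =
        ∑ k, constProfile Ω ξ i k ω * S (t k) ω - linQuad (Gam P G S t 0 θ) b (ξ i) := fun ω => by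
      have h := hu (constProfile Ω ξ i) ω
      rwa [Function.update_eq_self] at h
    rw [expectedCARA_of_integrable]
    · simp_rw [hfun]
      rw [integral_sub (hi hmem) (integrable_const _), integral_sum_strategy_mul hS ht hmem]
      simp
    · simp_rw [hfun]
      exact (hi hmem).sub (integrable_const _)
  rw [hrhs]
  refine expectedCARA_le fun hint => ?_
  rw [← integral_sum_strategy_mul hS ht hη]
  have : ∫ ω, (∑ k, η k ω * S (t k) ω - linQuad (Gam P G S t 0 θ) b (ξ i)) ∂P =
      ∫ ω, ∑ k, η k ω * S (t k) ω ∂P - linQuad (Gam P G S t 0 θ) b (ξ i) := by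
    rw [integral_sub (hi hη) (integrable_const _)]
    simp
  rw [← this]
  -- For each `ω` the realized trades form an admissible deterministic strategy, so the
  -- deterministic minimum applies pointwise.
  refine integral_mono hint ((hi hη).sub (integrable_const _)) fun ω => ?_
  simp only [hu]
  exact sub_le_sub_left (hmin _ (hη.2.2 ω)) _

lemma varMatrix_bachelier [IsProbabilityMeasure P] {B : ℝ≥0 → Ω → ℝ} (hB : IsBrownianReal B P)
    {S₀ σ : ℝ} (hSB : ∀ t ω, S t ω = S₀ + σ * B t ω) (k l : Fin (N + 1)) :
    varMatrix P S t k l = σ ^ 2 * ((min (t k) (t l) : ℝ≥0) : ℝ) := by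
  have hS : S (min (t k) (t l)) = fun ω => S₀ + σ * B (min (t k) (t l)) ω := funext (hSB _)
  have hm := hB.toIsPreBrownianReal.aemeasurable (min (t k) (t l))
  rw [varMatrix, Matrix.of_apply, hS,
    variance_const_add (hm.const_mul σ).aestronglyMeasurable, variance_const_mul,
    ← covariance_self hm, hB.toIsPreBrownianReal.covariance_eval, min_self]

/-- In the Bachelier model, the exponential of the scaled costs is the exponential of the
deterministic mean-variance functional, evaluated along the strategy, times a probability
density. -/
lemma exists_density_exp_cost [IsProbabilityMeasure P] {B : ℝ≥0 → Ω → ℝ}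
    (hB : IsFilteredBrownian B ℱ P) {S₀ σ : ℝ} (hSB : ∀ t ω, S t ω = S₀ + σ * B t ω)
    (ht : StrictMono t) (ξ : Fin n → Fin (N + 1) → ℝ) (i : Fin n) {x : ℝ}
    {η : Fin (N + 1) → Ω → ℝ} (hη : η ∈ adaptedStrategies ℱ t x) :
    ∃ Z : Ω → ℝ, (∀ ω, 0 ≤ Z ω) ∧ Integrable Z P ∧ ∫ ω, Z ω ∂P = 1 ∧
      ∀ ω, Real.exp (γ * cost G S t θ (Function.update (constProfile Ω ξ) i η) i ω) =
        Real.exp (γ * (linQuad (Gam P G S t γ θ) (GamTilde P G S t *ᵥ ∑ j with j ≠ i, ξ j)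
          (fun k => η k ω) - S₀ * x)) * Z ω := by
  -- The scale `-(γ σ)` is the coefficient of the Brownian term in `γ C`. Its compensator `(γ σ)² /
  -- 2` is exactly `γ` times the variance penalty `γ / 2`, which upgrades `Γ^{0,θ}` to `Γ^{γ,θ}`.
  set L : Ω → ℝ := fun ω => ∑ k, (-(γ * σ) * η k ω) * B (t k) ω - 1 / 2 *
    ∑ k, (-(γ * σ) * η k ω) * ∑ l, ((min (t k) (t l) : ℝ≥0) : ℝ) * (-(γ * σ) * η l ω) with hL
  have hηm : ∀ k, Measurable (η k) := fun k => (hη.1 k).mono (ℱ.le _) le_rfl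
  have hBm : ∀ s, Measurable (B s) := fun s => (hB.adapted s).measurable.mono (ℱ.le _) le_rfl
  have hLm : Measurable fun ω => Real.exp (L ω) := by fun_prop
  have hL1 : ∫⁻ ω, ENNReal.ofReal (Real.exp (L ω)) ∂P = 1 :=
    lintegral_exp_strategy hB ht.monotone (x := -(γ * σ) * x)
      (η := fun k ω => -(γ * σ) * η k ω) (fun k => (hη.1 k).const_mul _)
      (fun ω => by rw [← Finset.mul_sum, hη.2.2])
  have hpos : ∀ ω, 0 ≤ Real.exp (L ω) := fun ω => (Real.exp_pos _).le
  refine ⟨fun ω => Real.exp (L ω), hpos, ⟨hLm.aestronglyMeasurable, ?_⟩, ?_, fun ω => ?_⟩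
  · rw [hasFiniteIntegral_iff_ofReal (Filter.Eventually.of_forall hpos), hL1]
    exact ENNReal.one_lt_top
  · rw [integral_eq_lintegral_of_nonneg_ae (Filter.Eventually.of_forall hpos)
      hLm.aestronglyMeasurable, hL1, ENNReal.toReal_one]
  · rw [cost_update_constProfile P ht, ← Real.exp_add, linQuad_Gam (γ := γ)]
    congr 1
    have h1 : ∑ k, η k ω * S (t k) ω = S₀ * x + σ * ∑ k, η k ω * B (t k) ω := by
      rw [← hη.2.2 ω, Finset.mul_sum, Finset.mul_sum, ← Finset.sum_add_distrib]
      exact Finset.sum_congr rfl fun k _ => by rw [hSB]; ring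
    have h2 : (fun k => η k ω) ⬝ᵥ (varMatrix P S t *ᵥ fun k => η k ω) =
        σ ^ 2 * ∑ k, η k ω * ∑ l, ((min (t k) (t l) : ℝ≥0) : ℝ) * η l ω := by
      simp only [dotProduct, Matrix.mulVec, varMatrix_bachelier hB.isBrownian hSB, Finset.mul_sum]
      exact Finset.sum_congr rfl fun k _ => Finset.sum_congr rfl fun l _ => by ring
    have h3 : L ω = -(γ * σ) * ∑ k, η k ω * B (t k) ω - 1 / 2 * ((γ * σ) ^ 2 *
        ∑ k, η k ω * ∑ l, ((min (t k) (t l) : ℝ≥0) : ℝ) * η l ω) := by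
      simp only [hL, Finset.mul_sum]
      congr 1
      · exact Finset.sum_congr rfl fun k _ => by ring
      · exact Finset.sum_congr rfl fun k _ => Finset.sum_congr rfl fun l _ => by ring
    rw [h1, h2, h3]
    ring

/-- Optimality among adapted strategies in the risk-averse case. -/
lemma expectedCARA_pos_le [IsProbabilityMeasure P] (hγ : 0 < γ) {B : ℝ≥0 → Ω → ℝ}
    (hB : IsFilteredBrownian B ℱ P) {S₀ σ : ℝ} (hSB : ∀ t ω, S t ω = S₀ + σ * B t ω)
    (ht : StrictMono t) {ξ : Fin n → Fin (N + 1) → ℝ} {i : Fin n} {x : ℝ} (hξ : ∑ k, ξ i k = x)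
    (hmin : ∀ y : Fin (N + 1) → ℝ, ∑ k, y k = x →
      linQuad (Gam P G S t γ θ) (GamTilde P G S t *ᵥ ∑ j with j ≠ i, ξ j) (ξ i) ≤
        linQuad (Gam P G S t γ θ) (GamTilde P G S t *ᵥ ∑ j with j ≠ i, ξ j) y)
    {η : Fin (N + 1) → Ω → ℝ} (hη : η ∈ adaptedStrategies ℱ t x) :
    expectedCARA P G S t θ γ (Function.update (constProfile Ω ξ) i η) i ≤
      expectedCARA P G S t θ γ (constProfile Ω ξ) i := by
  set b := GamTilde P G S t *ᵥ ∑ j with j ≠ i, ξ j with hb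
  set q : ℝ := linQuad (Gam P G S t γ θ) b (ξ i) with hq
  have hu : ∀ y : ℝ, caraUtility γ (-y) = 1 / γ * (1 - Real.exp (γ * y)) := fun y => by
    rw [caraUtility, if_neg hγ.ne', neg_mul_neg]
  have hmem := constProfile_mem_adaptedStrategies (Ω := Ω) (ℱ := ℱ) (t := t) hξ
  obtain ⟨Z', -, hZi', hZ1', hZ'⟩ := exists_density_exp_cost (G := G) (θ := θ) (γ := γ)
    hB hSB ht ξ i hmem
  obtain ⟨Z, hZ0, hZi, hZ1, hZ⟩ := exists_density_exp_cost (G := G) (θ := θ) (γ := γ)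
    hB hSB ht ξ i hη
  rw [Function.update_eq_self] at hZ'
  have hint : ∀ {Y : Ω → ℝ}, Integrable Y P → Integrable
      (fun ω => 1 / γ * (1 - Real.exp (γ * (q - S₀ * x)) * Y ω)) P := fun hY =>
    ((integrable_const _).sub (hY.const_mul _)).const_mul _
  have hval : ∀ {Y : Ω → ℝ}, Integrable Y P → ∫ ω, Y ω ∂P = 1 →
      ∫ ω, 1 / γ * (1 - Real.exp (γ * (q - S₀ * x)) * Y ω) ∂P =
        1 / γ * (1 - Real.exp (γ * (q - S₀ * x))) := fun hY hY1 => by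
    rw [integral_const_mul, integral_sub (integrable_const _) (hY.const_mul _),
      integral_const_mul, hY1]
    simp
  have hfun : ∀ ω, caraUtility γ (-cost G S t θ (constProfile Ω ξ) i ω) =
      1 / γ * (1 - Real.exp (γ * (q - S₀ * x)) * Z' ω) := fun ω => by
    rw [hu, hZ']
    rfl
  have hrhs : expectedCARA P G S t θ γ (constProfile Ω ξ) i =
      ((1 / γ * (1 - Real.exp (γ * (q - S₀ * x))) : ℝ) : EReal) := by
    rw [expectedCARA_of_integrable]
    · simp_rw [hfun]
      rw [hval hZi' hZ1']
    · simp_rw [hfun]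
      exact hint hZi'
  rw [hrhs]
  refine expectedCARA_le fun hi => ?_
  -- The optimal value is the same for every density, so it is rewritten with the density of the
  -- competitor `η`; the two integrands then compare pointwise.
  rw [← hval hZi hZ1]
  refine integral_mono hi (hint hZi) fun ω => ?_
  simp only [hu, hZ]
  have hle := hmin _ (hη.2.2 ω)
  have h0 := hZ0 ω
  gcongr

lemma isCARANash_optStrategy [IsProbabilityMeasure P] (hS : IsUnaffectedPrice S ℱ P)
    (hG : IsStrictlyPosDef fun x : ℝ => (G (Real.nnabs x) : ℝ)) (ht : StrictMono t)
    (hθ : 0 ≤ θ) (hγ : 0 ≤ γ) (hn : 1 ≤ n) (X : Fin n → ℝ) (hB : IsBachelier S ℱ P) :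
    IsCARANash P ℱ G S t θ γ X (constProfile Ω (optStrategy P G S t θ γ X)) := by
  obtain ⟨hX, hmin⟩ := (isMeanVarianceNash_iff_linQuad hS ht X _).mp
    ((isMeanVarianceNash_iff hS hG ht hθ hγ hn X _).mpr rfl)
  obtain ⟨S₀, σ, B, -, -, hBB, hSB⟩ := hB
  refine ⟨fun i => constProfile_mem_adaptedStrategies (hX i), fun i η hη => ?_⟩
  have hm := hmin i
  rw [hX i] at hm
  rcases hγ.eq_or_lt with rfl | hγ'
  · exact expectedCARA_zero_le hS.martingale ht (hX i) hm hη
  · exact expectedCARA_pos_le hγ' hBB hSB ht (hX i) hm hη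

end CARA

end MarketImpact

theorem theorem2p1 {Ω : Type*} {mΩ : MeasurableSpace Ω} (P : Measure Ω) [IsProbabilityMeasure P]
    (ℱ : Filtration ℝ≥0 mΩ) (S : ℝ≥0 → Ω → ℝ) (hS : MarketImpact.IsUnaffectedPrice S ℱ P)
    (G : ℝ≥0 → ℝ≥0)
    (hG : MarketImpact.IsStrictlyPosDef fun x : ℝ => (G (Real.nnabs x) : ℝ))
    (n : ℕ) (hn : 1 ≤ n) (N : ℕ) (t : Fin (N + 1) → ℝ≥0) (ht : StrictMono t)
    (θ γ : ℝ) (hθ : 0 ≤ θ) (hγ : 0 ≤ γ) (X : Fin n → ℝ) :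
    -- the vectors `v` and `w` are well defined
    (IsUnit (MarketImpact.matV P n G S t γ θ).det ∧
      1 ⬝ᵥ ((MarketImpact.matV P n G S t γ θ)⁻¹ *ᵥ 1) ≠ 0 ∧
      IsUnit (MarketImpact.matW P G S t γ θ).det ∧
      1 ⬝ᵥ ((MarketImpact.matW P G S t γ θ)⁻¹ *ᵥ 1) ≠ 0) ∧
    -- unique Nash equilibrium for mean-variance optimization
    (∀ ξ : Fin n → Fin (N + 1) → ℝ,
      MarketImpact.IsMeanVarianceNash P G S t θ γ X ξ ↔
        ξ = MarketImpact.optStrategy P G S t θ γ X) ∧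
    -- Nash equilibrium for CARA utility maximization in the Bachelier model
    (MarketImpact.IsBachelier S ℱ P →
      MarketImpact.IsCARANash P ℱ G S t θ γ X
        (MarketImpact.constProfile Ω (MarketImpact.optStrategy P G S t θ γ X))) := by
  have hV := MarketImpact.matV_pos hS hG ht hθ hγ hn
  have hW := MarketImpact.matW_pos hS hG ht hθ hγ
  exact ⟨⟨MarketImpact.isUnit_det_of_quadratic_pos hV, MarketImpact.one_dotProduct_inv_ne_zero hV,
      MarketImpact.isUnit_det_of_quadratic_pos hW, MarketImpact.one_dotProduct_inv_ne_zero hW⟩,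
    MarketImpact.isMeanVarianceNash_iff hS hG ht hθ hγ hn X,
    MarketImpact.isCARANash_optStrategy hS hG ht hθ hγ hn X⟩
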